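/- A snake with $N$ edges in the $n$-dimensional hypercube $\{0,1\}^n$ is a sequence of vertices $p_0,\dots,p_N$ such that consecutive vertices differ in exactly one bit, and for $k>j+1$ the vertices $p_j$ and $p_k$ are neither equal nor adjacent. Its snake game is the $n$-player game with action set $\{0,1\}$ for each player in which every player receives the same utility $u(a)=k+1$ if $a=p_k$ for some $k$, and $u(a)=0$ if the joint action $a$ is not on the path. A run of fictitious play is a sequence $x^{(1)},x^{(2)},\dots$ of joint mixed strategies such that for all $t\ge 1$ and every player $i$, $x_i^{(t+1)}$ is a pure strategy that maximizes $\langle x_i,\sum_{\tau=1}^{t}u_i^{(\tau)}\rangle$ over $x_i$ in the simplex of player $i$, where $u_i^{(\tau)}[a]=u_i(a,x_{-i}^{(\tau)})$ is the expected utility of action $a$ against the strategies of the others in iteration $\tau$. Ties are broken arbitrarily. A joint mixed strategy is an $\epsilon$-Nash equilibrium if no player can gain more than $\epsilon$ in expected utility by a unilateral deviation. **Theorem.** There is an absolute constant $C>0$ such that for every $n\ge 1$ there is a snake $p_0,\dots,p_N$ in the $n$-dimensional hypercube with $N\ge C\cdot 2^n$ whose snake game, an $n$-player binary-action identical-interest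 (hence potential) game, has the following properties. 1. For every $0\le\epsilon<1$ (in particular for exact Nash equilibria, $\epsilon=0$) and every run of fictitious play with $x^{(1)}=p_0$, if $x^{(t)}$ is an $\epsilon$-Nash equilibrium, then $t\ge \lfloor C\cdot 2^n\rfloor!$. 2. If $n\ge 2$, divide all payoffs by $N+1$; the result is an identical-interest (hence potential) game with payoffs in $[0,1]$. For every $0\le\epsilon\le 1/2^n$ and every run of fictitious play in it with $x^{(1)}=p_0$, if $x^{(t)}$ is an $\epsilon$-Nash equilibrium, then $t\ge 2^{C\cdot 2^n}$. -/

import Mathlib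

namespace FP

section Games

variable {ι : Type*} [Fintype ι] [DecidableEq ι] {A : ι → Type*} [∀ i, Fintype (A i)]

/-- The expected value of `f` under the product of the mixed strategies `x i`. -/
noncomputable def expectedUtility (f : (∀ i, A i) → ℝ) (x : ∀ i, A i → ℝ) : ℝ :=
  ∑ a : ∀ i, A i, (∏ i, x i (a i)) * f a

/-- `x` is a joint mixed strategy: each player has a probability distribution on her actions. -/
def IsMixedProfile (x : ∀ i, A i → ℝ) : Prop :=
  ∀ i, x i ∈ stdSimplex ℝ (A i)

/-- The joint mixed strategy `x` is an `ε`-Nash equilibrium of the normal-form game in which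
player `i` has utility `u i`. -/
def IsEpsNash (u : ι → (∀ i, A i) → ℝ) (ε : ℝ) (x : ∀ i, A i → ℝ) : Prop :=
  IsMixedProfile x ∧
    ∀ i, ∀ y ∈ stdSimplex ℝ (A i),
      expectedUtility (u i) (Function.update x i y) ≤ expectedUtility (u i) x + ε

/-- All players have the same utility function. -/
def IsIdenticalInterest (u : ι → (∀ i, A i) → ℝ) : Prop :=
  ∀ i j, u i = u j

/-- Exact potential games: a single function of the joint mixed strategy records the change of
utility under every unilateral deviation. -/
def IsPotentialGame (u : ι → (∀ i, A i) → ℝ) : Prop :=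
  ∃ Φ : (∀ i, A i → ℝ) → ℝ,
    ∀ x : ∀ i, A i → ℝ, IsMixedProfile x →
      ∀ i, ∀ y ∈ stdSimplex ℝ (A i), ∀ y' ∈ stdSimplex ℝ (A i),
        expectedUtility (u i) (Function.update x i y) -
            expectedUtility (u i) (Function.update x i y') =
          Φ (Function.update x i y) - Φ (Function.update x i y')

variable [∀ i, DecidableEq (A i)]

/-- The joint mixed strategy in which player `i` plays the action `a i` with probability one. -/
def pureProfile (a : ∀ i, A i) : ∀ i, A i → ℝ :=
  fun i => Pi.single (a i) 1

/-- The utility vector that player `i` observes when the joint strategy is `x`: the entry at `b` is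
the expected utility of playing `b` against the strategies of the other players. -/
noncomputable def utilityVector (u : ι → (∀ i, A i) → ℝ) (i : ι) (x : ∀ i, A i → ℝ) : A i → ℝ :=
  fun b => expectedUtility (u i) (Function.update x i (Pi.single b 1))

/-- The sum of the utility vectors that player `i` observes in iterations `1, …, t`. -/
noncomputable def cumulativeUtility (u : ι → (∀ i, A i) → ℝ) (x : ℕ → ∀ i, A i → ℝ) (i : ι)
    (t : ℕ) : A i → ℝ :=
  ∑ τ ∈ Finset.Icc 1 t, utilityVector u i (x τ)

/-- `x 1, x 2, …` is a run of (simultaneous) fictitious play, under some tie-breaking: in each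
iteration after the first, each player plays a pure strategy that maximizes the cumulative utility
over her simplex. The value `x 0` plays no role. -/
structure IsFictitiousPlay (u : ι → (∀ i, A i) → ℝ) (x : ℕ → ∀ i, A i → ℝ) : Prop where
  mixed_one : IsMixedProfile (x 1)
  pure_succ : ∀ t, 1 ≤ t → ∀ i, ∃ b : A i, x (t + 1) i = Pi.single b 1
  argmax : ∀ t, 1 ≤ t → ∀ i, ∀ y ∈ stdSimplex ℝ (A i),
    y ⬝ᵥ cumulativeUtility u x i t ≤ x (t + 1) i ⬝ᵥ cumulativeUtility u x i t

end Games

section Snakes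

variable {n N : ℕ}

/-- `p 0, …, p N` is a snake (in the box) with `N` edges in the `n`-dimensional hypercube:
consecutive vertices differ in exactly one bit, and once the path has left a vertex for the next
one, it visits neither that vertex nor any other neighbour of it. -/
structure IsSnake (p : Fin (N + 1) → (Fin n → Bool)) : Prop where
  step : ∀ j k : Fin (N + 1), (j : ℕ) + 1 = k → hammingDist (p j) (p k) = 1
  avoid : ∀ j k : Fin (N + 1), (j : ℕ) + 1 < k → p j ≠ p k ∧ hammingDist (p j) (p k) ≠ 1

/-- The `n`-player binary-action game of a snake: every player receives the position of the joint
action on the path, counted from `1`, and `0` off the path. (The vertices of a snake are distinct,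
so at most one summand is not zero.) -/
def snakeGame (p : Fin (N + 1) → (Fin n → Bool)) : Fin n → (Fin n → Bool) → ℝ :=
  fun _ a => ∑ k : Fin (N + 1), if p k = a then ((k : ℕ) : ℝ) + 1 else 0

/-- The same game with its payoffs divided by the largest payoff `N + 1`. -/
noncomputable def scaledSnakeGame (p : Fin (N + 1) → (Fin n → Bool)) :
    Fin n → (Fin n → Bool) → ℝ :=
  fun i a => snakeGame p i a / ((N : ℝ) + 1)

end Snakes

end FP

/-!
The edges of the Gray code, a Hamiltonian path in the hypercube, can be coloured with eight colours
such that edges with equal or adjacent endpoints get different colours. In eight further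
coordinates, let the path carry the indicator of the colour of the edge it is traversing and change
it, in two steps, between one edge and the next. The result is a snake whose length is a constant
fraction of `2 ^ n`.

Fictitious play cannot leave the snake: at the vertex `k`, every player but the one who moves to the
vertex `k + 1` strictly prefers her current action, and an action that is played has never been
behind. The player who moves next leaves the snake, and loses her whole payoff `k + 1`, if she
deviates already at the vertex `k`. So if the run stays there for `j` iterations, it builds up a
lead of at least `(k + 1) * j` for her current action, and once the run is at the vertex `k + 1`,
where the move gains only `1`, it takes as many iterations to offset this lead. Hence the run stays
at the vertex `k` for at least `k !` iterations. None of the vertices before the last one is an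
equilibrium.
-/

open FP

namespace FictitiousPlay

section HammingDist

theorem hammingDist_cons {m : ℕ} {β : Fin (m + 1) → Type*} [∀ i, DecidableEq (β i)] (a b : β 0)
    (x y : ∀ i : Fin m, β i.succ) :
    hammingDist (Fin.cons a x : ∀ i, β i) (Fin.cons b y) =
      (if a = b then 0 else 1) + hammingDist x y := by
  simp only [hammingDist, Finset.card_filter, Fin.sum_univ_succ, Fin.cons_zero, Fin.cons_succ,
    ne_eq, ite_not]

theorem hammingDist_append {β : Type*} [DecidableEq β] {m r : ℕ} (x y : Fin m → β)
    (z w : Fin r → β) :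
    hammingDist (Fin.append x z) (Fin.append y w) = hammingDist x y + hammingDist z w := by
  simp only [hammingDist, Finset.card_filter, Fin.sum_univ_add, Fin.append_left, Fin.append_right]

variable {ι : Type*} [DecidableEq ι]

/-- The neighbour of the vertex `a` of the hypercube along coordinate `i`. -/
def flipAt (i : ι) (a : ι → Bool) : ι → Bool :=
  Function.update a i (!a i)

theorem flipAt_flipAt (i : ι) (a : ι → Bool) : flipAt i (flipAt i a) = a := by
  simp [flipAt]

theorem flipAt_ne (i : ι) (a : ι → Bool) : flipAt i a ≠ a := by
  simp [flipAt]

theorem flipAt_apply_of_ne {i j : ι} (h : j ≠ i) (a : ι → Bool) : flipAt i a j = a j :=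
  Function.update_of_ne h _ _

theorem flipAt_injective_left (a : ι → Bool) : Function.Injective fun i => flipAt i a := by
  intro i j h
  by_contra hij
  simpa [flipAt, hij] using congrFun h i

variable [Fintype ι]

theorem hammingDist_eq_one_iff {a b : ι → Bool} :
    hammingDist a b = 1 ↔ ∃ i, b = flipAt i a := by
  simp only [hammingDist, Finset.card_eq_one, Finset.ext_iff, Finset.mem_filter_univ,
    Finset.mem_singleton]
  refine exists_congr fun i => ⟨fun h => funext fun j => ?_, ?_⟩
  · rcases eq_or_ne j i with rfl | hj
    · simpa [flipAt] using Bool.eq_not.2 ((h j).2 rfl).symm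
    · simpa [flipAt, hj, eq_comm] using (h j).not.2 hj
  · rintro rfl j
    rcases eq_or_ne j i with rfl | hj <;> simp [flipAt, *]

theorem hammingDist_flipAt (i : ι) (a : ι → Bool) : hammingDist a (flipAt i a) = 1 :=
  hammingDist_eq_one_iff.2 ⟨i, rfl⟩

theorem hammingDist_flipAt_flipAt (i : ι) (a b : ι → Bool) :
    hammingDist (flipAt i a) (flipAt i b) = hammingDist a b := by
  simp only [hammingDist]
  congr 1
  ext j
  rw [Finset.mem_filter_univ, Finset.mem_filter_univ]
  rcases eq_or_ne j i with rfl | hj <;> simp [flipAt, *]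

end HammingDist

section GrayCode

/-- The vertices `grayCode m 0, …, grayCode m (2 ^ m - 1)` of the Hamiltonian path in the
`m`-dimensional hypercube given by the reflected binary Gray code, least significant bit first:
coordinate `i` is the sum modulo two of the binary digits `i` and `i + 1` of `t`. -/
def grayCode : (m : ℕ) → ℕ → Fin m → Bool
  | 0, _ => Fin.elim0
  | m + 1, t => Fin.cons (decide ((t + t / 2) % 2 = 1)) (grayCode m (t / 2))

theorem hammingDist_grayCode_succ (m s t : ℕ) :
    hammingDist (grayCode (m + 1) s) (grayCode (m + 1) t) =
      (if (s + s / 2) % 2 = (t + t / 2) % 2 then 0 else 1) +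
        hammingDist (grayCode m (s / 2)) (grayCode m (t / 2)) := by
  rw [grayCode, grayCode, hammingDist_cons]
  congr 1
  simp only [decide_eq_decide]
  split_ifs <;> omega

theorem hammingDist_grayCode_mod_two {m s t : ℕ} (hs : s < 2 ^ m) (ht : t < 2 ^ m) :
    hammingDist (grayCode m s) (grayCode m t) % 2 = (s + t) % 2 := by
  induction m generalizing s t with
  | zero =>
    obtain rfl : s = 0 := by omega
    obtain rfl : t = 0 := by omega
    rw [hammingDist_self]
  | succ m ih =>
    have := ih (s := s / 2) (t := t / 2) (by omega) (by omega)
    rw [hammingDist_grayCode_succ]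
    split_ifs <;> omega

theorem grayCode_injOn (m : ℕ) : Set.InjOn (grayCode m) (Set.Iio (2 ^ m)) := by
  induction m with
  | zero =>
    intro s hs t ht _
    simp only [pow_zero, Set.mem_Iio, Nat.lt_one_iff] at hs ht
    rw [hs, ht]
  | succ m ih =>
    intro s hs t ht h
    rw [Set.mem_Iio] at hs ht
    rw [← hammingDist_eq_zero, hammingDist_grayCode_succ, Nat.add_eq_zero_iff,
      hammingDist_eq_zero] at h
    have := ih (Set.mem_Iio.2 (by omega)) (Set.mem_Iio.2 (by omega)) h.2
    have := h.1
    split_ifs at this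
    omega

theorem hammingDist_grayCode_add_one {m t : ℕ} (ht : t + 1 < 2 ^ m) :
    hammingDist (grayCode m t) (grayCode m (t + 1)) = 1 := by
  induction m generalizing t with
  | zero => omega
  | succ m ih =>
    rw [hammingDist_grayCode_succ]
    rcases Nat.even_or_odd' t with ⟨k, rfl | rfl⟩
    · rw [if_neg (by omega), show (2 * k + 1) / 2 = 2 * k / 2 by omega, hammingDist_self]
    · rw [if_pos (by omega), show (2 * k + 1) / 2 = k by omega,
        show (2 * k + 1 + 1) / 2 = k + 1 by omega, ih (by omega)]

end GrayCode

section StrongColoring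

/-- The edges `i` and `j` of the path `h`, of which edge `i` joins `h i` to `h (i + 1)`, have
endpoints that are equal or adjacent. -/
def EdgesClose {m : ℕ} (h : ℕ → Fin m → Bool) (i j : ℕ) : Prop :=
  ∃ a ∈ Set.Icc i (i + 1), ∃ b ∈ Set.Icc j (j + 1), hammingDist (h a) (h b) ≤ 1

/-- The edges of the path `h 0, …, h M` are coloured by `c` such that no two close edges share a
colour: a strong edge colouring, in the sense of graph theory, with respect to the hypercube. -/
def IsStrongColoring {κ : Type*} {m : ℕ} (M : ℕ) (h : ℕ → Fin m → Bool) (c : ℕ → κ) : Prop :=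
  ∀ i j, i < j → j < M → EdgesClose h i j → c i ≠ c j

theorem EdgesClose.mod_two_ne_of_even {m i j : ℕ} (hij : i < j) (hj : j < 2 ^ m)
    (h : EdgesClose (grayCode (m + 1)) (2 * i) (2 * j)) : i % 2 ≠ j % 2 := by
  obtain ⟨a, ⟨ha, ha'⟩, b, ⟨hb, hb'⟩, hd⟩ := h
  rw [hammingDist_grayCode_succ, show a / 2 = i by omega, show b / 2 = j by omega] at hd
  have hpos : 0 < hammingDist (grayCode m i) (grayCode m j) :=
    hammingDist_pos.2 ((grayCode_injOn m).ne (Set.mem_Iio.2 (by omega)) hj hij.ne)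
  have := hammingDist_grayCode_mod_two (hij.trans hj) hj
  omega

theorem EdgesClose.eq_succ_or_of_odd {m i j : ℕ} (hij : i < j) (hj : j + 1 < 2 ^ m)
    (h : EdgesClose (grayCode (m + 1)) (2 * i + 1) (2 * j + 1)) :
    j = i + 1 ∨ i % 2 = j % 2 ∧ EdgesClose (grayCode m) i j := by
  obtain ⟨a, ⟨ha, ha'⟩, b, ⟨hb, hb'⟩, hd⟩ := h
  rw [hammingDist_grayCode_succ] at hd
  by_cases hpar : i % 2 = j % 2
  · exact Or.inr ⟨hpar, a / 2, ⟨by omega, by omega⟩, b / 2, ⟨by omega, by omega⟩, by omega⟩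
  · have bit_eq {c k : ℕ} (hc : c = 2 * k + 1 ∨ c = 2 * k + 2) :
        (c + c / 2) % 2 = (k + 1) % 2 := by
      rcases hc with rfl | rfl <;> omega
    rw [bit_eq (k := i) (by omega), bit_eq (k := j) (by omega), if_neg (by omega)] at hd
    have heq : grayCode m (a / 2) = grayCode m (b / 2) := hammingDist_eq_zero.1 (by omega)
    have := grayCode_injOn m (Set.mem_Iio.2 (by omega)) (Set.mem_Iio.2 (by omega)) heq
    omega

/-- Some element of `ZMod 3` other than `x` and `y`. -/
def thirdColor (x y : ZMod 3) : ZMod 3 :=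
  if x = y then x + 1 else -(x + y)

theorem thirdColor_ne_left : ∀ x y, thirdColor x y ≠ x := by
  decide

theorem thirdColor_ne_right : ∀ x y, thirdColor x y ≠ y := by
  decide

/-- A colouring of the edges of `grayCode m` that separates close edges of equal parity. Edge
`2 * k + 1` of `grayCode (m + 1)` inherits the colour of edge `k` of `grayCode m`; edge `2 * k`
lies over vertex `k` of `grayCode m` and is coloured by the parity of `k`. The second component
serves to separate consecutive edges. -/
def grayEdgeColor : ℕ → ℕ → ZMod 2 × ZMod 3
  | 0, t => (0, t)
  | m + 1, t =>
    if t % 2 = 1 then grayEdgeColor m (t / 2)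
    else ((t / 2 : ℕ), thirdColor (grayEdgeColor m (t / 2 - 1)).2 (grayEdgeColor m (t / 2)).2)

theorem grayEdgeColor_succ_odd (m k : ℕ) :
    grayEdgeColor (m + 1) (2 * k + 1) = grayEdgeColor m k := by
  rw [grayEdgeColor, if_pos (by omega), show (2 * k + 1) / 2 = k by omega]

theorem grayEdgeColor_succ_even (m k : ℕ) :
    grayEdgeColor (m + 1) (2 * k) =
      ((k : ZMod 2), thirdColor (grayEdgeColor m (k - 1)).2 (grayEdgeColor m k).2) := by
  rw [grayEdgeColor, if_neg (by omega), show 2 * k / 2 = k by omega]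

theorem grayEdgeColor_snd_ne_succ (m t : ℕ) :
    (grayEdgeColor m t).2 ≠ (grayEdgeColor m (t + 1)).2 := by
  cases m with
  | zero => simp [grayEdgeColor]
  | succ m =>
    rcases Nat.even_or_odd' t with ⟨k, rfl | rfl⟩
    · rw [grayEdgeColor_succ_odd, grayEdgeColor_succ_even]
      exact thirdColor_ne_right _ _
    · rw [grayEdgeColor_succ_odd, show 2 * k + 1 + 1 = 2 * (k + 1) by ring,
        grayEdgeColor_succ_even]
      exact (thirdColor_ne_left _ _).symm

theorem grayEdgeColor_ne {m i j : ℕ} (hij : i < j) (hj : j + 1 < 2 ^ m) (hpar : i % 2 = j % 2)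
    (h : EdgesClose (grayCode m) i j) : grayEdgeColor m i ≠ grayEdgeColor m j := by
  induction m generalizing i j with
  | zero => omega
  | succ m ih =>
    rcases Nat.even_or_odd' i with ⟨k, rfl | rfl⟩
    · obtain ⟨l, rfl⟩ : ∃ l, j = 2 * l := ⟨j / 2, by omega⟩
      have := h.mod_two_ne_of_even (by omega) (by omega)
      rw [grayEdgeColor_succ_even, grayEdgeColor_succ_even]
      exact fun e => this ((ZMod.natCast_eq_natCast_iff' _ _ _).1 (Prod.ext_iff.1 e).1)
    · obtain ⟨l, rfl⟩ : ∃ l, j = 2 * l + 1 := ⟨j / 2, by omega⟩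
      rw [grayEdgeColor_succ_odd, grayEdgeColor_succ_odd]
      rcases h.eq_succ_or_of_odd (by omega) (by omega) with rfl | ⟨hkl, hclose⟩
      · exact fun e => grayEdgeColor_snd_ne_succ m k (congrArg Prod.snd e)
      · exact ih (by omega) (by omega) hkl hclose

/-- A strong edge colouring of `grayCode (m + 1)`: the odd edges inherit the colours of the edges
of `grayCode m`, and the even ones, for which parity suffices, use two further colours. -/
def grayStrongColor (m t : ℕ) : ZMod 2 × ZMod 3 ⊕ ZMod 2 :=
  if t % 2 = 1 then Sum.inl (grayEdgeColor m (t / 2)) else Sum.inr (t / 2 : ℕ)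

theorem isStrongColoring_grayStrongColor (m : ℕ) :
    IsStrongColoring (2 ^ (m + 1) - 1) (grayCode (m + 1)) (grayStrongColor m) := by
  have hodd (k : ℕ) : grayStrongColor m (2 * k + 1) = Sum.inl (grayEdgeColor m k) := by
    rw [grayStrongColor, if_pos (by omega), show (2 * k + 1) / 2 = k by omega]
  have heven (k : ℕ) : grayStrongColor m (2 * k) = Sum.inr (k : ZMod 2) := by
    rw [grayStrongColor, if_neg (by omega), show 2 * k / 2 = k by omega]
  intro i j hij hj h
  rcases Nat.even_or_odd' i with ⟨k, rfl | rfl⟩ <;> rcases Nat.even_or_odd' j with ⟨l, rfl | rfl⟩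
  · have := h.mod_two_ne_of_even (by omega) (by omega)
    rwa [heven, heven, Sum.inr_injective.ne_iff, ne_eq, ZMod.natCast_eq_natCast_iff']
  · rw [heven, hodd]
    exact Sum.inr_ne_inl
  · rw [heven, hodd]
    exact Sum.inl_ne_inr
  · rw [hodd, hodd, Sum.inl_injective.ne_iff]
    rcases h.eq_succ_or_of_odd (by omega) (by omega) with rfl | ⟨hkl, hclose⟩
    · exact fun e => grayEdgeColor_snd_ne_succ m k (congrArg Prod.snd e)
    · exact grayEdgeColor_ne (by omega) (by omega) hkl hclose

end StrongColoring

section SnakeConstruction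

/-- The indicator function of `{a, b}`. -/
def pairIndicator {κ : Type*} [DecidableEq κ] (a b : κ) : κ → Bool :=
  fun j => decide (j = a ∨ j = b)

section PairIndicator

variable {κ : Type*} [DecidableEq κ] {a b c d : κ}

theorem pairIndicator_comm (a b : κ) : pairIndicator a b = pairIndicator b a := by
  funext j
  simp only [pairIndicator, or_comm]

theorem pairIndicator_ne (hac : a ≠ c) (had : a ≠ d) : pairIndicator a b ≠ pairIndicator c d :=
  fun e => by simpa [pairIndicator, hac, had] using congrFun e a

theorem pairIndicator_eq_flipAt (hab : a ≠ b) :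
    pairIndicator a b = flipAt b (pairIndicator a a) := by
  funext j
  rcases eq_or_ne j b with rfl | hj <;> simp [pairIndicator, flipAt, *, hab.symm]

theorem one_lt_hammingDist_pairIndicator [Fintype κ] (hab : a ≠ b) :
    1 < hammingDist (pairIndicator a a) (pairIndicator b b) :=
  Finset.one_lt_card.2
    ⟨a, by simp [pairIndicator, hab], b, by simp [pairIndicator, hab.symm], hab⟩

end PairIndicator

variable {m r M n N : ℕ}

theorem isSnake_of_hammingDist {q : ℕ → Fin n → Bool}
    (step : ∀ t < N, hammingDist (q t) (q (t + 1)) = 1)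
    (avoid : ∀ s t, s + 1 < t → t ≤ N → 1 < hammingDist (q s) (q t)) :
    IsSnake fun k : Fin (N + 1) => q k where
  step j k hjk := by
    rw [← hjk]
    exact step j (by omega)
  avoid j k hjk := by
    have := avoid j k hjk (by omega)
    exact ⟨hammingDist_pos.1 (by omega), this.ne'⟩

/-- The path in a larger hypercube that takes three steps for every edge of `h`: while the label in
the additional coordinates is the indicator of the colour `c i`, it traverses edge `i`; then the
label changes to that of `c (i + 1)` by way of the indicator of both colours. -/
def labelledPath (h : ℕ → Fin m → Bool) (c : ℕ → Fin r) (t : ℕ) : Fin (m + r) → Bool :=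
  Fin.append (h ((t + 2) / 3)) (pairIndicator (c (t / 3)) (c ((t + 1) / 3)))

variable {h : ℕ → Fin m → Bool} {c : ℕ → Fin r}

theorem labelledPath_three_mul (i : ℕ) :
    labelledPath h c (3 * i) = Fin.append (h i) (pairIndicator (c i) (c i)) := by
  rw [labelledPath, show (3 * i + 2) / 3 = i by omega, show 3 * i / 3 = i by omega,
    show (3 * i + 1) / 3 = i by omega]

theorem labelledPath_three_mul_add_one (i : ℕ) :
    labelledPath h c (3 * i + 1) = Fin.append (h (i + 1)) (pairIndicator (c i) (c i)) := by
  rw [labelledPath, show (3 * i + 1 + 2) / 3 = i + 1 by omega, show (3 * i + 1) / 3 = i by omega,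
    show (3 * i + 1 + 1) / 3 = i by omega]

theorem labelledPath_three_mul_add_two (i : ℕ) :
    labelledPath h c (3 * i + 2) = Fin.append (h (i + 1)) (pairIndicator (c i) (c (i + 1))) := by
  rw [labelledPath, show (3 * i + 2 + 2) / 3 = i + 1 by omega,
    show (3 * i + 2) / 3 = i by omega, show (3 * i + 2 + 1) / 3 = i + 1 by omega]

theorem IsStrongColoring.ne_succ (hc : IsStrongColoring M h c) {i : ℕ} (hi : i + 1 < M) :
    c i ≠ c (i + 1) :=
  hc i (i + 1) (by omega) hi
    ⟨i + 1, ⟨by omega, le_rfl⟩, i + 1, ⟨le_rfl, by omega⟩, by simp⟩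

theorem IsStrongColoring.hammingDist_labelledPath_succ (hc : IsStrongColoring M h c)
    (step : ∀ i < M, hammingDist (h i) (h (i + 1)) = 1) {t : ℕ} (ht : t + 2 < 3 * M) :
    hammingDist (labelledPath h c t) (labelledPath h c (t + 1)) = 1 := by
  obtain ⟨i, rfl | rfl | rfl⟩ : ∃ i, t = 3 * i ∨ t = 3 * i + 1 ∨ t = 3 * i + 2 :=
    ⟨t / 3, by omega⟩
  · rw [labelledPath_three_mul, labelledPath_three_mul_add_one, hammingDist_append,
      hammingDist_self, step i (by omega)]
  · rw [labelledPath_three_mul_add_one, labelledPath_three_mul_add_two, hammingDist_append,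
      hammingDist_self, zero_add, pairIndicator_eq_flipAt (hc.ne_succ (by omega)),
      hammingDist_flipAt]
  · rw [labelledPath_three_mul_add_two, show 3 * i + 2 + 1 = 3 * (i + 1) by ring,
      labelledPath_three_mul, hammingDist_append, hammingDist_self, zero_add, pairIndicator_comm,
      pairIndicator_eq_flipAt (hc.ne_succ (by omega)).symm, hammingDist_comm, hammingDist_flipAt]

theorem IsStrongColoring.pairIndicator_ne (hc : IsStrongColoring M h c) {s t : ℕ}
    (hst : s + 1 < t) (ht : t + 1 < 3 * M)
    (hd : hammingDist (h ((s + 2) / 3)) (h ((t + 2) / 3)) ≤ 1) :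
    pairIndicator (c (s / 3)) (c ((s + 1) / 3)) ≠ pairIndicator (c (t / 3)) (c ((t + 1) / 3)) := by
  have color_ne (i j : ℕ) (hij : i < j) (hi : i = s / 3 ∨ i = (s + 1) / 3)
      (hj : j = t / 3 ∨ j = (t + 1) / 3) : c i ≠ c j :=
    hc i j hij (by omega)
      ⟨(s + 2) / 3, ⟨by omega, by omega⟩, (t + 2) / 3, ⟨by omega, by omega⟩, hd⟩
  rcases lt_or_ge (s / 3) (t / 3) with hlt | hge
  · exact FictitiousPlay.pairIndicator_ne (color_ne _ _ hlt (by omega) (by omega))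
      (color_ne _ _ (by omega) (by omega) (by omega))
  · rw [pairIndicator_comm (c (t / 3))]
    exact (FictitiousPlay.pairIndicator_ne
      (color_ne _ _ (by omega) (by omega) (by omega)).symm
      (color_ne _ _ (by omega) (by omega) (by omega)).symm).symm

theorem IsStrongColoring.one_lt_hammingDist_labelledPath (hc : IsStrongColoring M h c)
    (inj : Set.InjOn h (Set.Iic M)) {s t : ℕ} (hst : s + 1 < t) (ht : t + 1 < 3 * M) :
    1 < hammingDist (labelledPath h c s) (labelledPath h c t) := by
  rcases eq_or_ne ((s + 2) / 3) ((t + 2) / 3) with heq | hne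
  · obtain ⟨i, rfl⟩ : ∃ i, s = 3 * i + 1 := ⟨s / 3, by omega⟩
    obtain rfl : t = 3 * (i + 1) := by omega
    rw [labelledPath_three_mul_add_one, labelledPath_three_mul, hammingDist_append,
      hammingDist_self, zero_add]
    exact one_lt_hammingDist_pairIndicator (hc.ne_succ (by omega))
  · have hpos : 0 < hammingDist (h ((s + 2) / 3)) (h ((t + 2) / 3)) :=
      hammingDist_pos.2 (inj.ne (Set.mem_Iic.2 (by omega)) (Set.mem_Iic.2 (by omega)) hne)
    rw [labelledPath, labelledPath, hammingDist_append]
    by_contra! hle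
    have := hammingDist_pos.2 (hc.pairIndicator_ne hst ht (by omega))
    omega

theorem IsStrongColoring.isSnake_labelledPath (hc : IsStrongColoring M h c)
    (inj : Set.InjOn h (Set.Iic M)) (step : ∀ i < M, hammingDist (h i) (h (i + 1)) = 1)
    (hM : 1 ≤ M) : IsSnake fun k : Fin (3 * M - 2 + 1) => labelledPath h c k :=
  isSnake_of_hammingDist (fun _ ht => hc.hammingDist_labelledPath_succ step (by omega))
    fun _ _ hst ht => hc.one_lt_hammingDist_labelledPath inj hst (by omega)

theorem isSnake_edge (i : Fin n) (a : Fin n → Bool) : IsSnake ![a, flipAt i a] where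
  step j k hjk := by
    obtain rfl : j = 0 := Fin.ext (by simp only [Fin.val_zero]; omega)
    obtain rfl : k = 1 := Fin.ext (by simp only [Fin.val_one]; omega)
    exact hammingDist_flipAt i a
  avoid j k hjk := by omega

theorem exists_isSnake_add_nine (m : ℕ) :
    ∃ p : Fin (3 * (2 ^ (m + 1) - 1) - 2 + 1) → Fin (m + 9) → Bool, IsSnake p := by
  have h2 : 2 ≤ 2 ^ (m + 1) := Nat.le_self_pow (by omega) 2
  let e : ZMod 2 × ZMod 3 ⊕ ZMod 2 ≃ Fin 8 := Fintype.equivFinOfCardEq rfl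
  have hc : IsStrongColoring (2 ^ (m + 1) - 1) (grayCode (m + 1)) (e ∘ grayStrongColor m) :=
    fun i j hij hj h => e.injective.ne (isStrongColoring_grayStrongColor m i j hij hj h)
  exact ⟨_, hc.isSnake_labelledPath
    ((grayCode_injOn _).mono fun i (hi : i ≤ _) => Set.mem_Iio.2 (by omega))
    (fun i hi => hammingDist_grayCode_add_one (by omega)) (by omega)⟩

theorem exists_isSnake_two_pow_le (hn : 1 ≤ n) :
    ∃ (N : ℕ) (p : Fin (N + 1) → Fin n → Bool), IsSnake p ∧ 2 ^ n ≤ 512 * N := by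
  rcases le_or_gt n 9 with hn9 | hn9
  · refine ⟨1, _, isSnake_edge ⟨0, hn⟩ fun _ => false, ?_⟩
    simpa using Nat.pow_le_pow_right two_pos hn9
  · obtain ⟨m, rfl⟩ := Nat.exists_eq_add_of_le' hn9.le
    obtain ⟨p, hp⟩ := exists_isSnake_add_nine m
    refine ⟨_, p, hp, ?_⟩
    have := Nat.one_le_two_pow (n := m)
    rw [pow_add, pow_succ]
    omega

end SnakeConstruction

section Games

theorem update_pureProfile {ι : Type*} [DecidableEq ι] {A : ι → Type*} [∀ i, DecidableEq (A i)]
    (a : ∀ i, A i) (i : ι) (b : A i) :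
    Function.update (pureProfile a) i (Pi.single b 1) = pureProfile (Function.update a i b) := by
  funext j
  rcases eq_or_ne j i with rfl | hj <;> simp [pureProfile, *]

variable {ι : Type*} [Fintype ι] [DecidableEq ι] {A : ι → Type*} [∀ i, Fintype (A i)]

theorem isPotentialGame_of_isIdenticalInterest {u : ι → (∀ i, A i) → ℝ}
    (hu : IsIdenticalInterest u) : IsPotentialGame u := by
  rcases isEmpty_or_nonempty ι with _ | ⟨⟨i₀⟩⟩
  · exact ⟨0, fun _ _ i => isEmptyElim i⟩
  · exact ⟨expectedUtility (u i₀), fun _ _ i _ _ _ _ => by rw [hu i i₀]⟩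

theorem expectedUtility_smul (c : ℝ) (f : (∀ i, A i) → ℝ) (x : ∀ i, A i → ℝ) :
    expectedUtility (c • f) x = c * expectedUtility f x := by
  simp only [expectedUtility, Finset.mul_sum, Pi.smul_apply, smul_eq_mul, mul_left_comm c]

theorem isEpsNash_of_smul {u : ι → (∀ i, A i) → ℝ} {c ε : ℝ} (hc : 0 < c) {x : ∀ i, A i → ℝ}
    (hx : IsEpsNash (c • u) ε x) : IsEpsNash u (c⁻¹ * ε) x := by
  refine ⟨hx.1, fun i y hy => le_of_mul_le_mul_left ?_ hc⟩
  have h := hx.2 i y hy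
  rwa [Pi.smul_apply, expectedUtility_smul, expectedUtility_smul,
    ← mul_inv_cancel_left₀ hc.ne' ε, ← mul_add] at h

variable [∀ i, DecidableEq (A i)]

theorem cumulativeUtility_smul (c : ℝ) (u : ι → (∀ i, A i) → ℝ) (x : ℕ → ∀ i, A i → ℝ) (i : ι)
    (t : ℕ) : cumulativeUtility (c • u) x i t = c • cumulativeUtility u x i t := by
  rw [cumulativeUtility, cumulativeUtility, Finset.smul_sum]
  exact Finset.sum_congr rfl fun τ _ => funext fun b => expectedUtility_smul c (u i) _

theorem expectedUtility_pureProfile (f : (∀ i, A i) → ℝ) (a : ∀ i, A i) :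
    expectedUtility f (pureProfile a) = f a := by
  have hprod (b : ∀ i, A i) : ∏ i, pureProfile a i (b i) = if b = a then 1 else 0 := by
    simp only [pureProfile, Pi.single_apply, Finset.prod_ite_zero, Finset.prod_const_one,
      Finset.mem_univ, true_implies, funext_iff]
  simp only [expectedUtility, hprod, ite_mul, one_mul, zero_mul, Finset.sum_ite_eq',
    Finset.mem_univ, if_true]

theorem utilityVector_pureProfile (u : ι → (∀ i, A i) → ℝ) (i : ι) (a : ∀ i, A i) (b : A i) :
    utilityVector u i (pureProfile a) b = u i (Function.update a i b) := by
  rw [utilityVector, update_pureProfile, expectedUtility_pureProfile]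

theorem not_isEpsNash_pureProfile {u : ι → (∀ i, A i) → ℝ} {ε : ℝ} {a : ∀ i, A i} {i : ι} {b : A i}
    (h : u i a + ε < u i (Function.update a i b)) : ¬ IsEpsNash u ε (pureProfile a) := by
  rintro ⟨-, hnash⟩
  have := hnash i (Pi.single b 1) (single_mem_stdSimplex ℝ b)
  rw [update_pureProfile, expectedUtility_pureProfile, expectedUtility_pureProfile] at this
  exact this.not_gt h

/-- The advantage of the action `b` over the action `c` of player `i` in iterations `1, …, t`: what
she would have gained by always playing `b` instead of always playing `c`. -/
noncomputable def advantage (u : ι → (∀ i, A i) → ℝ) (x : ℕ → ∀ i, A i → ℝ) (i : ι) (b c : A i)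
    (t : ℕ) : ℝ :=
  cumulativeUtility u x i t b - cumulativeUtility u x i t c

theorem advantage_zero (u : ι → (∀ i, A i) → ℝ) (x : ℕ → ∀ i, A i → ℝ) (i : ι) (b c : A i) :
    advantage u x i b c 0 = 0 := by
  simp [advantage, cumulativeUtility]

theorem neg_advantage (u : ι → (∀ i, A i) → ℝ) (x : ℕ → ∀ i, A i → ℝ) (i : ι) (b c : A i)
    (t : ℕ) : -advantage u x i b c t = advantage u x i c b t :=
  neg_sub _ _

theorem advantage_succ (u : ι → (∀ i, A i) → ℝ) {x : ℕ → ∀ i, A i → ℝ} {t : ℕ} {a : ∀ i, A i}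
    (hx : x (t + 1) = pureProfile a) (i : ι) (c : A i) :
    advantage u x i (a i) c (t + 1) =
      advantage u x i (a i) c t + (u i a - u i (Function.update a i c)) := by
  simp only [advantage, cumulativeUtility, Finset.sum_Icc_succ_top (Nat.le_add_left 1 t), hx,
    Pi.add_apply, utilityVector_pureProfile, Function.update_eq_self]
  ring

end Games

end FictitiousPlay

namespace FP.IsFictitiousPlay

open FictitiousPlay

variable {ι : Type*} [Fintype ι] [DecidableEq ι] {A : ι → Type*} [∀ i, Fintype (A i)]
  [∀ i, DecidableEq (A i)] {u : ι → (∀ i, A i) → ℝ} {x : ℕ → ∀ i, A i → ℝ} {t : ℕ} {i : ι}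

theorem of_smul {c : ℝ} (hc : 0 < c) (hx : IsFictitiousPlay (c • u) x) : IsFictitiousPlay u x where
  mixed_one := hx.mixed_one
  pure_succ := hx.pure_succ
  argmax t ht i y hy := by
    have := hx.argmax t ht i y hy
    rw [cumulativeUtility_smul, dotProduct_smul, dotProduct_smul] at this
    exact le_of_smul_le_smul_left this hc

theorem advantage_nonneg (hx : IsFictitiousPlay u x) {b : A i} (hb : x (t + 1) i = Pi.single b 1)
    (c : A i) : 0 ≤ advantage u x i b c t := by
  rcases Nat.eq_zero_or_pos t with rfl | ht
  · exact (advantage_zero u x i b c).ge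
  · have := hx.argmax t ht i (Pi.single c 1) (single_mem_stdSimplex ℝ c)
    rw [hb, single_one_dotProduct, single_one_dotProduct] at this
    exact sub_nonneg.2 this

/-- An action that is played has never been behind, so it stays ahead if the last iteration has
favoured it. -/
theorem eq_single_of_forall_update_lt (hx : IsFictitiousPlay u x) {a : ∀ i, A i} (ht : 1 ≤ t)
    (hxt : x t = pureProfile a) (h : ∀ c, c ≠ a i → u i (Function.update a i c) < u i a) :
    x (t + 1) i = Pi.single (a i) 1 := by
  obtain ⟨s, rfl⟩ := Nat.exists_eq_add_of_le' ht
  obtain ⟨c, hc⟩ := hx.pure_succ (s + 1) ht i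
  rcases eq_or_ne c (a i) with rfl | hne
  · exact hc
  · have hpast : 0 ≤ advantage u x i (a i) c s :=
      hx.advantage_nonneg (by rw [hxt, pureProfile]) c
    have hnow : 0 ≤ advantage u x i c (a i) (s + 1) := hx.advantage_nonneg hc (a i)
    rw [← neg_advantage, advantage_succ u hxt] at hnow
    linarith [h c hne]

end FP.IsFictitiousPlay

namespace FictitiousPlay

section SnakeGames

variable {n N : ℕ} {p : Fin (N + 1) → Fin n → Bool}

theorem snakeGame_apply (hp : Function.Injective p) (i : Fin n) (k : Fin (N + 1)) :
    snakeGame p i (p k) = k + 1 := by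
  simp only [snakeGame, hp.eq_iff, Finset.sum_ite_eq', Finset.mem_univ, if_true]

theorem snakeGame_of_notMem_range {a : Fin n → Bool} (ha : a ∉ Set.range p) (i : Fin n) :
    snakeGame p i a = 0 :=
  Finset.sum_eq_zero fun k _ => if_neg fun hk => ha ⟨k, hk⟩

theorem scaledSnakeGame_eq_smul (p : Fin (N + 1) → Fin n → Bool) :
    scaledSnakeGame p = (N + 1 : ℝ)⁻¹ • snakeGame p :=
  funext₂ fun _ _ => div_eq_inv_mul _ _

theorem scaledSnakeGame_mem_Icc (hp : Function.Injective p) (i : Fin n) (a : Fin n → Bool) :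
    scaledSnakeGame p i a ∈ Set.Icc (0 : ℝ) 1 := by
  by_cases ha : a ∈ Set.range p
  · obtain ⟨k, rfl⟩ := ha
    have hk : (k : ℝ) ≤ N := by exact_mod_cast Fin.is_le k
    rw [scaledSnakeGame, snakeGame_apply hp]
    exact ⟨by positivity, (div_le_one (by positivity)).2 (by linarith)⟩
  · rw [scaledSnakeGame, snakeGame_of_notMem_range ha, zero_div]
    exact ⟨le_rfl, zero_le_one⟩

/-- The path `p` as a sequence indexed by the natural numbers, constant from `N` on. -/
def vertex (p : Fin (N + 1) → Fin n → Bool) (k : ℕ) : Fin n → Bool :=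
  p ⟨min k N, by omega⟩

theorem vertex_val (p : Fin (N + 1) → Fin n → Bool) (k : Fin (N + 1)) : vertex p k = p k :=
  congrArg p (Fin.ext (min_eq_left (Fin.is_le k)))

/-- Player `i` moves at vertex `k`: she is the one whose action changes from vertex `k` to its
successor. -/
def IsMover (p : Fin (N + 1) → Fin n → Bool) (k : ℕ) (i : Fin n) : Prop :=
  vertex p (k + 1) = flipAt i (vertex p k)

variable {k : ℕ} {i i' : Fin n}

theorem IsMover.lt (hi : IsMover p k i) : k < N := by
  by_contra! hk
  have heq : vertex p (k + 1) = vertex p k := congrArg p (Fin.ext (by simp only; omega))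
  exact flipAt_ne i _ (hi.symm.trans heq)

theorem IsMover.unique (hi : IsMover p k i) (hi' : IsMover p k i') : i = i' :=
  flipAt_injective_left _ (hi.symm.trans hi')

end SnakeGames

end FictitiousPlay

namespace FP.IsSnake

open FictitiousPlay

variable {n N : ℕ} {p : Fin (N + 1) → Fin n → Bool} {i : Fin n} {j k : ℕ}

theorem exists_isMover (hp : IsSnake p) (hk : k < N) : ∃ i, IsMover p k i :=
  hammingDist_eq_one_iff.1 (hp.step _ _ (by simp only; omega))

theorem eq_succ_of_hammingDist_le_one (hp : IsSnake p) (hjk : j < k) (hk : k ≤ N)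
    (hd : hammingDist (vertex p j) (vertex p k) ≤ 1) : k = j + 1 := by
  by_contra hne
  obtain ⟨hvertex, hadj⟩ := hp.avoid ⟨min j N, by omega⟩ ⟨min k N, by omega⟩ (by simp only; omega)
  have : 0 < hammingDist (vertex p j) (vertex p k) := hammingDist_pos.2 hvertex
  exact hadj (by change hammingDist (vertex p j) (vertex p k) = 1; omega)

theorem vertex_ne (hp : IsSnake p) (hjk : j < k) (hk : k ≤ N) : vertex p j ≠ vertex p k := by
  intro heq
  obtain rfl := hp.eq_succ_of_hammingDist_le_one hjk hk (by simp [heq])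
  obtain ⟨i, hi⟩ := hp.exists_isMover (k := j) hk
  exact flipAt_ne i _ (hi.symm.trans heq.symm)

theorem injective (hp : IsSnake p) : Function.Injective p := by
  refine Function.Injective.of_lt_imp_ne fun j k hjk => ?_
  rw [← vertex_val p j, ← vertex_val p k]
  exact hp.vertex_ne hjk (Fin.is_le k)

theorem snakeGame_vertex (hp : IsSnake p) (i : Fin n) (hk : k ≤ N) :
    snakeGame p i (vertex p k) = k + 1 := by
  have := snakeGame_apply hp.injective i ⟨k, by omega⟩
  rwa [← vertex_val p] at this

theorem succ_eq_or_isMover_of_vertex_eq_flipAt (hp : IsSnake p) (hj : j ≤ N) (hk : k ≤ N)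
    (h : vertex p j = flipAt i (vertex p k)) : j + 1 = k ∨ IsMover p k i := by
  have hd : hammingDist (vertex p k) (vertex p j) = 1 := by rw [h, hammingDist_flipAt]
  rcases lt_trichotomy j k with hlt | rfl | hgt
  · rw [hammingDist_comm] at hd
    exact Or.inl (hp.eq_succ_of_hammingDist_le_one hlt hk hd.le).symm
  · exact absurd h.symm (flipAt_ne i _)
  · obtain rfl := hp.eq_succ_of_hammingDist_le_one hgt hj hd.le
    exact Or.inr h

theorem flipAt_vertex_notMem_range (hp : IsSnake p) (hk : k ≤ N)
    (hpred : ∀ j, j + 1 = k → vertex p j ≠ flipAt i (vertex p k)) (hi : ¬ IsMover p k i) :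
    flipAt i (vertex p k) ∉ Set.range p := by
  rintro ⟨j, hj⟩
  rw [← vertex_val p] at hj
  rcases hp.succ_eq_or_isMover_of_vertex_eq_flipAt (Fin.is_le j) hk hj with hjk | hmover
  · exact hpred j hjk hj
  · exact hi hmover

theorem snakeGame_flipAt_of_isMover (hp : IsSnake p) (hi : IsMover p k i) (i' : Fin n) :
    snakeGame p i' (flipAt i (vertex p k)) = k + 2 := by
  rw [← hi, hp.snakeGame_vertex i' hi.lt]
  push_cast
  ring

theorem snakeGame_flipAt_le (hp : IsSnake p) (hk : k ≤ N) (hi : ¬ IsMover p k i) (i' : Fin n) :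
    snakeGame p i' (flipAt i (vertex p k)) ≤ k := by
  by_cases h : ∃ j, j + 1 = k ∧ vertex p j = flipAt i (vertex p k)
  · obtain ⟨j, rfl, hj⟩ := h
    rw [← hj, hp.snakeGame_vertex i' (by omega)]
    push_cast
    rfl
  · rw [snakeGame_of_notMem_range (hp.flipAt_vertex_notMem_range hk (by simpa using h) hi)]
    exact k.cast_nonneg

theorem not_isMover_of_isMover_succ (hp : IsSnake p) (hi : IsMover p (k + 1) i) :
    ¬ IsMover p k i := by
  intro hk
  have heq : vertex p (k + 2) = vertex p k := by rw [hi, hk, flipAt_flipAt]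
  exact hp.vertex_ne (by omega) hi.lt heq.symm

theorem vertex_succ_apply_of_isMover_succ (hp : IsSnake p) (hi : IsMover p (k + 1) i) :
    vertex p (k + 1) i = vertex p k i := by
  obtain ⟨l, hl⟩ := hp.exists_isMover (k := k) (by have := hi.lt; omega)
  have hil : i ≠ l := by
    rintro rfl
    exact hp.not_isMover_of_isMover_succ hi hl
  rw [hl, flipAt_apply_of_ne hil]

theorem snakeGame_flipAt_of_isMover_succ (hp : IsSnake p) (hi : IsMover p (k + 1) i) (i' : Fin n) :
    snakeGame p i' (flipAt i (vertex p k)) = 0 := by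
  have hk : k + 1 < N := hi.lt
  refine snakeGame_of_notMem_range (hp.flipAt_vertex_notMem_range (by omega) ?_
    (hp.not_isMover_of_isMover_succ hi)) i'
  rintro j rfl heq
  have hd : hammingDist (vertex p j) (vertex p (j + 1 + 2)) ≤ 1 := by
    obtain ⟨l, hl⟩ := hp.exists_isMover (k := j + 1) (by omega)
    rw [heq, hi, hammingDist_flipAt_flipAt, hl, hammingDist_flipAt]
  have := hp.eq_succ_of_hammingDist_le_one (by omega) hk hd
  omega

theorem succ_lt_two_pow (hp : IsSnake p) (hn : 2 ≤ n) : N + 1 < 2 ^ n := by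
  obtain ⟨i, hi⟩ : ∃ i, ¬ IsMover p 0 i := by
    by_contra! h
    exact zero_ne_one (Fin.mk.inj ((h ⟨0, by omega⟩).unique (h ⟨1, by omega⟩)))
  have hmem : flipAt i (vertex p 0) ∉ Set.range p :=
    hp.flipAt_vertex_notMem_range (by omega) (by omega) hi
  simpa using Fintype.card_lt_of_injective_of_notMem p hp.injective hmem

end FP.IsSnake

namespace FictitiousPlay

section Dynamics

variable {n N : ℕ} {p : Fin (N + 1) → Fin n → Bool} {x : ℕ → Fin n → Bool → ℝ} {t k j : ℕ}
  {i : Fin n}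

/-- The advantage, in iterations `1, …, t` of a play `x` of the snake game, of the action of player
`i` at vertex `k` of the snake over her other action. -/
noncomputable def lead (p : Fin (N + 1) → Fin n → Bool) (x : ℕ → Fin n → Bool → ℝ) (i : Fin n)
    (k t : ℕ) : ℝ :=
  advantage (snakeGame p) x i (vertex p k i) (!vertex p k i) t

theorem lead_succ (hx : x (t + 1) = pureProfile (vertex p k)) (i : Fin n) :
    lead p x i k (t + 1) =
      lead p x i k t + (snakeGame p i (vertex p k) - snakeGame p i (flipAt i (vertex p k))) :=
  advantage_succ _ hx i _

theorem lead_nonneg (hx : IsFictitiousPlay (snakeGame p) x)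
    (h : x (t + 1) = pureProfile (vertex p k)) (i : Fin n) : 0 ≤ lead p x i k t :=
  hx.advantage_nonneg (by rw [h, pureProfile]) _

theorem lead_succ_of_isMover (hp : IsSnake p) (hx : x (t + 1) = pureProfile (vertex p k))
    (hi : IsMover p k i) : lead p x i k (t + 1) = lead p x i k t - 1 := by
  rw [lead_succ hx, hp.snakeGame_vertex i hi.lt.le, hp.snakeGame_flipAt_of_isMover hi]
  ring

theorem lead_succ_of_isMover_succ (hp : IsSnake p) (hx : x (t + 1) = pureProfile (vertex p k))
    (hi : IsMover p (k + 1) i) : lead p x i k (t + 1) = lead p x i k t + (k + 1) := by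
  have hk : k + 1 < N := hi.lt
  rw [lead_succ hx, hp.snakeGame_vertex i (by omega), hp.snakeGame_flipAt_of_isMover_succ hi,
    sub_zero]

theorem lead_vertex_succ_of_isMover_succ (hp : IsSnake p) (hi : IsMover p (k + 1) i) (t : ℕ) :
    lead p x i (k + 1) t = lead p x i k t := by
  rw [lead, lead, hp.vertex_succ_apply_of_isMover_succ hi]

/-- In iteration `t`, the play `x` is at vertex `k < N` of the snake, for at least the `j`-th time
in a row. The lead of the player who moves at vertex `k` is at least `k !` minus these `j`
iterations, each of which costs her `1`; the lead of the player who moves next has grown by `k + 1`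
in each of them. At vertex `0`, where no lead precedes the first iteration, `mover` is void. -/
structure PlaysVertex (p : Fin (N + 1) → Fin n → Bool) (x : ℕ → Fin n → Bool → ℝ)
    (t k j : ℕ) : Prop where
  lt : k < N
  eq : x t = pureProfile (vertex p k)
  one_le : 1 ≤ j
  le : j ≤ t
  mover : k ≠ 0 → ∀ i, IsMover p k i → (k.factorial : ℝ) - j ≤ lead p x i k t
  next_mover : ∀ i, IsMover p (k + 1) i → ((k : ℝ) + 1) * j ≤ lead p x i k t

namespace PlaysVertex

theorem one (hp : IsSnake p) (hN : 1 ≤ N) (hx : x 1 = pureProfile (p 0)) :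
    PlaysVertex p x 1 0 1 where
  lt := hN
  eq := hx
  one_le := le_rfl
  le := le_rfl
  mover h := absurd rfl h
  next_mover i hi := by
    rw [lead_succ_of_isMover_succ hp hx hi, lead, advantage_zero]
    simp

theorem stay (H : PlaysVertex p x t k j) (hp : IsSnake p)
    (h : x (t + 1) = pureProfile (vertex p k)) : PlaysVertex p x (t + 1) k (j + 1) where
  lt := H.lt
  eq := h
  one_le := Nat.le_add_left 1 j
  le := Nat.succ_le_succ H.le
  mover hk i hi := by
    rw [lead_succ_of_isMover hp h hi]
    push_cast
    linarith [H.mover hk i hi]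
  next_mover i hi := by
    rw [lead_succ_of_isMover_succ hp h hi]
    push_cast
    linarith [H.next_mover i hi]

theorem move (H : PlaysVertex p x t k j) (hp : IsSnake p)
    (hx : IsFictitiousPlay (snakeGame p) x) (h : x (t + 1) = pureProfile (vertex p (k + 1)))
    (hk : k + 1 < N) (hj : k.factorial ≤ j) : PlaysVertex p x (t + 1) (k + 1) 1 where
  lt := hk
  eq := h
  one_le := le_rfl
  le := Nat.le_add_left 1 t
  mover _ i hi := by
    rw [lead_succ_of_isMover hp h hi, lead_vertex_succ_of_isMover_succ hp hi, Nat.cast_one]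
    gcongr
    calc ((k + 1).factorial : ℝ) = (k + 1) * k.factorial := by push_cast [Nat.factorial_succ]; rfl
      _ ≤ (k + 1) * j := by gcongr
      _ ≤ lead p x i k t := H.next_mover i hi
  next_mover i hi := by
    rw [lead_succ_of_isMover_succ hp h hi, Nat.cast_one, mul_one]
    linarith [lead_nonneg hx h i]

theorem eq_single_of_not_isMover (H : PlaysVertex p x t k j) (hp : IsSnake p)
    (hx : IsFictitiousPlay (snakeGame p) x) (hi : ¬ IsMover p k i) :
    x (t + 1) i = Pi.single (vertex p k i) 1 := by
  refine hx.eq_single_of_forall_update_lt (H.one_le.trans H.le) H.eq fun c hc => ?_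
  have hflip := hp.snakeGame_flipAt_le H.lt.le hi i
  rw [flipAt, ← Bool.eq_not.2 hc] at hflip
  rw [hp.snakeGame_vertex i H.lt.le]
  linarith

theorem factorial_le_of_eq_single_not (H : PlaysVertex p x t k j)
    (hx : IsFictitiousPlay (snakeGame p) x) (hi : IsMover p k i)
    (h : x (t + 1) i = Pi.single (!vertex p k i) 1) : k.factorial ≤ j := by
  rcases eq_or_ne k 0 with rfl | hk
  · exact H.one_le
  · have hbehind : 0 ≤ -lead p x i k t := by
      rw [lead, neg_advantage]
      exact hx.advantage_nonneg h _
    have : (k.factorial : ℝ) ≤ j := by linarith [H.mover hk i hi]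
    exact_mod_cast this

theorem stay_or_move (H : PlaysVertex p x t k j) (hp : IsSnake p)
    (hx : IsFictitiousPlay (snakeGame p) x) :
    x (t + 1) = pureProfile (vertex p k) ∨
      x (t + 1) = pureProfile (vertex p (k + 1)) ∧ k.factorial ≤ j := by
  obtain ⟨i₀, hi₀⟩ := hp.exists_isMover H.lt
  have hother (i : Fin n) (hi : i ≠ i₀) : x (t + 1) i = Pi.single (vertex p k i) 1 :=
    H.eq_single_of_not_isMover hp hx fun h => hi (h.unique hi₀)
  obtain ⟨b, hb⟩ := hx.pure_succ t (H.one_le.trans H.le) i₀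
  rcases Bool.eq_or_eq_not b (vertex p k i₀) with rfl | rfl
  · refine Or.inl (funext fun i => ?_)
    rcases eq_or_ne i i₀ with rfl | hi
    · exact hb
    · exact hother i hi
  · refine Or.inr ⟨?_, H.factorial_le_of_eq_single_not hx hi₀ hb⟩
    rw [hi₀, flipAt, ← update_pureProfile]
    funext i
    rcases eq_or_ne i i₀ with rfl | hi
    · rw [Function.update_self, hb]
    · rw [Function.update_of_ne hi, hother i hi, pureProfile]

theorem not_isEpsNash (H : PlaysVertex p x t k j) (hp : IsSnake p) {ε : ℝ} (hε : ε < 1) :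
    ¬ IsEpsNash (snakeGame p) ε (x t) := by
  obtain ⟨i, hi⟩ := hp.exists_isMover H.lt
  rw [H.eq]
  refine not_isEpsNash_pureProfile (i := i) (b := !vertex p k i) ?_
  change _ < snakeGame p i (flipAt i (vertex p k))
  rw [hp.snakeGame_vertex i H.lt.le, hp.snakeGame_flipAt_of_isMover hi]
  linarith

end PlaysVertex

theorem exists_playsVertex_or_factorial_lt (hp : IsSnake p) (hN : 1 ≤ N)
    (hx : IsFictitiousPlay (snakeGame p) x) (h1 : x 1 = pureProfile (p 0)) (ht : 1 ≤ t) :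
    (∃ k j, PlaysVertex p x t k j) ∨ (N - 1).factorial < t := by
  induction t, ht using Nat.le_induction with
  | base => exact Or.inl ⟨0, 1, PlaysVertex.one hp hN h1⟩
  | succ t _ ih =>
    rcases ih with ⟨k, j, H⟩ | hlt
    · rcases H.stay_or_move hp hx with hstay | ⟨hmove, hj⟩
      · exact Or.inl ⟨k, j + 1, H.stay hp hstay⟩
      · rcases (Nat.succ_le_of_lt H.lt).eq_or_lt with rfl | hk
        · exact Or.inr (Nat.lt_succ_of_le (hj.trans H.le))
        · exact Or.inl ⟨k + 1, 1, H.move hp hx hmove hk hj⟩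
    · exact Or.inr (hlt.trans (Nat.lt_succ_self t))

theorem factorial_lt_of_isEpsNash (hp : IsSnake p) (hN : 1 ≤ N)
    (hx : IsFictitiousPlay (snakeGame p) x) (h1 : x 1 = pureProfile (p 0)) {ε : ℝ} (hε : ε < 1)
    (ht : 1 ≤ t) (hnash : IsEpsNash (snakeGame p) ε (x t)) : (N - 1).factorial < t := by
  rcases exists_playsVertex_or_factorial_lt hp hN hx h1 ht with ⟨k, j, H⟩ | hlt
  · exact absurd hnash (H.not_isEpsNash hp hε)
  · exact hlt

theorem factorial_lt_of_isEpsNash_scaledSnakeGame (hp : IsSnake p) (hN : 1 ≤ N) (hn : 2 ≤ n)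
    (hx : IsFictitiousPlay (scaledSnakeGame p) x) (h1 : x 1 = pureProfile (p 0)) {ε : ℝ}
    (hε : ε ≤ 1 / 2 ^ n) (ht : 1 ≤ t) (hnash : IsEpsNash (scaledSnakeGame p) ε (x t)) :
    (N - 1).factorial < t := by
  rw [scaledSnakeGame_eq_smul] at hx hnash
  have hpos : 0 < (N + 1 : ℝ)⁻¹ := by positivity
  refine factorial_lt_of_isEpsNash hp hN (hx.of_smul hpos) h1 ?_ ht (isEpsNash_of_smul hpos hnash)
  have hcard : (N + 1 : ℝ) < 2 ^ n := by exact_mod_cast hp.succ_lt_two_pow hn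
  calc (N + 1 : ℝ)⁻¹⁻¹ * ε ≤ (N + 1) * (1 / 2 ^ n) := by rw [inv_inv]; gcongr
    _ < 1 := by rwa [mul_one_div, div_lt_one (by positivity)]

end Dynamics

section Growth

theorem two_pow_succ_le_factorial_add_one_sq (k : ℕ) : 2 ^ (k + 1) ≤ (k.factorial + 1) ^ 2 := by
  induction k with
  | zero => decide
  | succ k ih =>
    rcases Nat.eq_zero_or_pos k with rfl | hk
    · decide
    · have hfac : 1 ≤ k.factorial := k.factorial_pos
      calc 2 ^ (k + 1 + 1) ≤ 2 * (k.factorial + 1) ^ 2 := by rw [pow_succ']; gcongr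
        _ ≤ (2 * k.factorial + 1) ^ 2 := by nlinarith
        _ ≤ ((k + 1).factorial + 1) ^ 2 := by rw [Nat.factorial_succ]; gcongr; omega

variable {c : ℝ} {N : ℕ}

theorem two_rpow_le_factorial_add_one (hN : 1 ≤ N) (hc : 2 * c ≤ N) :
    (2 : ℝ) ^ c ≤ (N - 1).factorial + 1 := by
  refine le_of_sq_le_sq ?_ (by positivity)
  calc ((2 : ℝ) ^ c) ^ 2 = 2 ^ (c * 2) := (Real.rpow_mul_natCast zero_le_two c 2).symm
    _ ≤ 2 ^ (N : ℝ) := by gcongr <;> linarith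
    _ = 2 ^ (N - 1 + 1) := by rw [Real.rpow_natCast, Nat.sub_add_cancel hN]
    _ ≤ ((N - 1).factorial + 1) ^ 2 := by exact_mod_cast two_pow_succ_le_factorial_add_one_sq _

theorem factorial_floor_le_factorial_sub_one (hN : 1 ≤ N) (hc : 2 * c ≤ N) :
    ⌊c⌋₊.factorial ≤ (N - 1).factorial := by
  have hN' : (1 : ℝ) ≤ N := by exact_mod_cast hN
  have hfloor : ⌊c⌋₊ < N := (Nat.floor_lt' (by omega)).2 (by linarith)
  exact Nat.factorial_le (by omega)

end Growth

end FictitiousPlay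

theorem mainTheorem3 :
    ∃ C : ℝ, 0 < C ∧ ∀ n : ℕ, 1 ≤ n →
      ∃ (N : ℕ) (p : Fin (N + 1) → (Fin n → Bool)),
        FP.IsSnake p ∧ C * 2 ^ n ≤ (N : ℝ) ∧
        FP.IsIdenticalInterest (FP.snakeGame p) ∧
        FP.IsPotentialGame (FP.snakeGame p) ∧
        (∀ x : ℕ → Fin n → Bool → ℝ,
          FP.IsFictitiousPlay (FP.snakeGame p) x → x 1 = FP.pureProfile (p 0) →
          ∀ ε : ℝ, 0 ≤ ε → ε < 1 → ∀ t : ℕ, 1 ≤ t →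
            FP.IsEpsNash (FP.snakeGame p) ε (x t) →
            Nat.factorial ⌊C * 2 ^ n⌋₊ ≤ t) ∧
        (2 ≤ n →
          (∀ i a, FP.scaledSnakeGame p i a ∈ Set.Icc (0 : ℝ) 1) ∧
          FP.IsIdenticalInterest (FP.scaledSnakeGame p) ∧
          FP.IsPotentialGame (FP.scaledSnakeGame p) ∧
          ∀ x : ℕ → Fin n → Bool → ℝ,
            FP.IsFictitiousPlay (FP.scaledSnakeGame p) x → x 1 = FP.pureProfile (p 0) →
            ∀ ε : ℝ, 0 ≤ ε → ε ≤ 1 / 2 ^ n → ∀ t : ℕ, 1 ≤ t →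
              FP.IsEpsNash (FP.scaledSnakeGame p) ε (x t) →
              (2 : ℝ) ^ (C * 2 ^ n) ≤ (t : ℝ)) := by
  open FictitiousPlay in
  refine ⟨1 / 1024, by norm_num, fun n hn => ?_⟩
  obtain ⟨N, p, hp, hlen⟩ := exists_isSnake_two_pow_le hn
  have hN : 1 ≤ N := by
    have := Nat.one_le_two_pow (n := n)
    omega
  have hC : 2 * (1 / 1024 * 2 ^ n : ℝ) ≤ N := by
    have : (2 ^ n : ℝ) ≤ 512 * N := by exact_mod_cast hlen
    linarith
  have hC' : (1 / 1024 * 2 ^ n : ℝ) ≤ N := by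
    have : (0 : ℝ) < 2 ^ n := by positivity
    linarith
  have hscaled : FP.IsIdenticalInterest (FP.scaledSnakeGame p) := fun _ _ => rfl
  have hsnake : FP.IsIdenticalInterest (FP.snakeGame p) := fun _ _ => rfl
  refine ⟨N, p, hp, hC', hsnake, isPotentialGame_of_isIdenticalInterest hsnake, ?_, fun hn2 =>
    ⟨scaledSnakeGame_mem_Icc hp.injective, hscaled,
      isPotentialGame_of_isIdenticalInterest hscaled, ?_⟩⟩
  · intro x hx h1 ε _ hε t ht hnash
    have hlt := factorial_lt_of_isEpsNash hp hN hx h1 hε ht hnash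
    exact (factorial_floor_le_factorial_sub_one hN hC).trans hlt.le
  · intro x hx h1 ε _ hε t ht hnash
    have hlt := factorial_lt_of_isEpsNash_scaledSnakeGame hp hN hn2 hx h1 hε ht hnash
    exact (two_rpow_le_factorial_add_one hN hC).trans (by exact_mod_cast hlt)
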